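/- Let $H$ be a finite-dimensional real Banach space, and let $J,\mu\in C^1(H,\mathbb R)$ satisfy $\mu(u)\ge 0$ for all $u\in H$, $\mu(0)=0$, and $\mu$ coercive, i.e. $\mu(u)\to+\infty$ as $\|u\|\to\infty$. Let $0<r<s$ be real numbers and assume that 1. $\displaystyle\liminf_{\mu(u)\to\infty}\frac{J(u)}{\mu(u)}\ge 0$; 2. $\displaystyle\inf_{u\in H}J(u)<\inf_{\mu(u)\le s}J(u)$ (the left-hand side may be $-\infty$); 3. $\displaystyle J(0)\le\inf_{r\le\mu(u)\le s}J(u)$. Then there is $\lambda^\star>0$ such that the functional $u\mapsto\mu(u)+\lambda^\star J(u)$ has at least three critical points in $H$, that is, at least three distinct points at which its Fréchet derivative vanishes. -/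

import Mathlib

open Filter Bornology

/-!
Fix `lam > 0` and write `F = μ + lam * J`. The growth condition on `J / μ` makes `F` coercive, so
`F` has global minimizers. For small `lam` all of them lie in `{μ ≤ s}`, for large `lam` all of them
lie in `{s ≤ μ}`, and on a compact interval of parameters each of the two sets
"`F` has a global minimizer in `{μ ≤ s}`" and "`F` has a global minimizer in `{s ≤ μ}`" is closed,
being the projection of a compact set. An interval is connected, so some `lam` belongs to both
(`exists_common_parameter`). For this `lam`, the hypothesis `J 0 ≤ J` on `{r ≤ μ ≤ s}` gives
`F ≥ F 0 + r` there, so one minimizer satisfies `μ < r` and the other `s < μ`, and every connected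
set joining them meets `{μ = r}`, where `F` exceeds its minimum by at least `r`.

A finite-dimensional mountain pass theorem (`exists_critical_point_of_barrier`) yields a third
critical point, at a strictly higher level. It needs no flow: let `c` be the infimum of the levels
`t` for which `{F ≤ t}` contains a preconnected set joining the minimizers. If no point at level `c`
is critical, a single explicit Euler step `y ↦ y - t • V y`, with `V` the coordinate gradient,
pushes all of `{F ≤ c}` strictly below `c` (`exists_step_lt`), hence by compactness also some
slightly larger sublevel set, and it fixes the two minimizers. This contradicts the choice of `c`.
-/

open scoped Topology

/-! ### Descent along the coordinate gradient -/

section Descent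

variable {H : Type*} [NormedAddCommGroup H] [NormedSpace ℝ H]

theorem HasStrictFDerivAt.eventually_sub_smul_lt {F : H → ℝ} {L : H →L[ℝ] ℝ} {x : H}
    (hF : HasStrictFDerivAt F L x) {V : H → H} (hV : Continuous V) (hpos : 0 < L (V x)) :
    ∀ᶠ p : ℝ × H in 𝓝 (0, x), 0 < p.1 → F (p.2 - p.1 • V p.2) < F p.2 := by
  set ε := L (V x) / (2 * (‖V x‖ + 1)) with hε
  have hε0 : 0 < ε := by positivity
  have hx : ε * ‖V x‖ < L (V x) := by
    rw [hε, div_mul_eq_mul_div, div_lt_iff₀ (by positivity)]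
    nlinarith [norm_nonneg (V x)]
  have h1 : ∀ᶠ p : ℝ × H in 𝓝 (0, x), ε * ‖V p.2‖ < L (V p.2) :=
    ContinuousAt.eventually_lt (f := fun p : ℝ × H => ε * ‖V p.2‖)
      (g := fun p : ℝ × H => L (V p.2)) (by fun_prop) (by fun_prop) hx
  have h2 : Tendsto (fun p : ℝ × H => (p.2 - p.1 • V p.2, p.2)) (𝓝 (0, x)) (𝓝 (x, x)) := by
    have : Continuous (fun p : ℝ × H => (p.2 - p.1 • V p.2, p.2)) := by fun_prop
    simpa using this.tendsto (0, x)
  filter_upwards [h1, h2.eventually (hF.isLittleO.bound hε0)] with p hp1 hp2 ht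
  simp only [sub_sub_cancel_left, map_neg, map_smul, norm_neg, norm_smul, smul_eq_mul,
    Real.norm_eq_abs, _root_.abs_of_pos ht] at hp2
  have h3 := (abs_le.1 hp2).2
  nlinarith [mul_lt_mul_of_pos_left hp1 ht]

variable [FiniteDimensional ℝ H]

/-- The gradient of `F` for the Euclidean structure in which the chosen basis
`Module.finBasis ℝ H` is orthonormal. -/
noncomputable def coordGradient (F : H → ℝ) (x : H) : H :=
  ∑ i, fderiv ℝ F x (Module.finBasis ℝ H i) • Module.finBasis ℝ H i

theorem continuous_coordGradient {F : H → ℝ} (hF : ContDiff ℝ 1 F) :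
    Continuous (coordGradient F) := by
  have := hF.continuous_fderiv one_ne_zero
  unfold coordGradient
  fun_prop

theorem coordGradient_eq_zero {F : H → ℝ} {x : H} (hx : fderiv ℝ F x = 0) :
    coordGradient F x = 0 := by
  simp [coordGradient, hx]

theorem fderiv_coordGradient_pos {F : H → ℝ} {x : H} (hx : fderiv ℝ F x ≠ 0) :
    0 < fderiv ℝ F x (coordGradient F x) := by
  simp only [coordGradient, map_sum, map_smul, smul_eq_mul]
  obtain ⟨i, hi⟩ : ∃ i, fderiv ℝ F x (Module.finBasis ℝ H i) ≠ 0 := by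
    by_contra! h
    exact hx (ContinuousLinearMap.coe_injective ((Module.finBasis ℝ H).ext h))
  exact Finset.sum_pos' (fun j _ => mul_self_nonneg _)
    ⟨i, Finset.mem_univ i, mul_self_pos.2 hi⟩

/-- Away from critical points at level `c`, one step along the coordinate gradient, of the same
length parameter for all points, pushes the whole sublevel set `{F ≤ c}` strictly below `c`. -/
theorem exists_step_lt {F : H → ℝ} (hF : ContDiff ℝ 1 F) {c : ℝ}
    (hcpt : IsCompact {x | F x ≤ c}) (hc : ∀ x, F x = c → fderiv ℝ F x ≠ 0) :
    ∃ t : ℝ, ∀ x, F x ≤ c → F (x - t • coordGradient F x) < c := by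
  have hV := continuous_coordGradient hF
  have hFc := hF.continuous
  have key : ∀ᶠ t : ℝ in 𝓝 0, ∀ x ∈ {x | F x ≤ c},
      0 < t → F x ≤ c → F (x - t • coordGradient F x) < c := by
    refine hcpt.eventually_forall_of_forall_eventually
      (P := fun t x => 0 < t → F x ≤ c → F (x - t • coordGradient F x) < c) fun x hx => ?_
    rcases (show F x ≤ c from hx).lt_or_eq with hlt | heq
    · have : ∀ᶠ p : ℝ × H in 𝓝 (0, x), F (p.2 - p.1 • coordGradient F p.2) < c :=
        ContinuousAt.eventually_lt (f := fun p : ℝ × H => F (p.2 - p.1 • coordGradient F p.2))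
          (g := fun _ => c) (by fun_prop) continuousAt_const (by simpa using hlt)
      filter_upwards [this] with p hp _ _ using hp
    · filter_upwards [(hF.hasStrictFDerivAt one_ne_zero).eventually_sub_smul_lt hV
        (fderiv_coordGradient_pos (hc x heq))] with p hp h0 hle using (hp h0).trans_le hle
  obtain ⟨t, ht, ht0⟩ := ((key.filter_mono nhdsWithin_le_nhds).and
    (self_mem_nhdsWithin : Set.Ioi (0 : ℝ) ∈ 𝓝[>] 0)).exists
  exact ⟨t, fun x hx => ht x hx ht0 hx⟩

/-! ### A finite-dimensional mountain pass theorem -/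

theorem isCompact_sublevel {F : H → ℝ} (hF : Continuous F)
    (hcoer : Tendsto F (cobounded H) atTop) (c : ℝ) : IsCompact {x | F x ≤ c} := by
  refine Metric.isCompact_of_isClosed_isBounded (isClosed_le hF continuous_const) ?_
  rw [← isCobounded_compl_iff]
  filter_upwards [hcoer.eventually_gt_atTop c] with x hx using not_le.2 hx

/-- If every preconnected set joining two critical points reaches the level `d`, then there is a
critical point at level at least `d`. -/
theorem exists_critical_point_of_barrier {F : H → ℝ} (hF : ContDiff ℝ 1 F)
    (hcoer : Tendsto F (cobounded H) atTop) {x y : H}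
    (hx : fderiv ℝ F x = 0) (hy : fderiv ℝ F y = 0) {d : ℝ}
    (hbar : ∀ K : Set H, IsPreconnected K → x ∈ K → y ∈ K → ∃ z ∈ K, d ≤ F z) :
    ∃ z, d ≤ F z ∧ fderiv ℝ F z = 0 := by
  by_contra! hcrit
  have hFc := hF.continuous
  set T : Set ℝ := {t | ∃ K : Set H, IsPreconnected K ∧ x ∈ K ∧ y ∈ K ∧ ∀ z ∈ K, F z ≤ t}
  have hTd : ∀ t ∈ T, d ≤ t := by
    rintro t ⟨K, hK, hxK, hyK, hKt⟩
    obtain ⟨z, hz, hdz⟩ := hbar K hK hxK hyK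
    exact hdz.trans (hKt z hz)
  have hTne : T.Nonempty := by
    have hseg : IsCompact (segment ℝ x y) := by
      rw [segment_eq_image_lineMap]
      exact isCompact_Icc.image (by fun_prop)
    obtain ⟨t, ht⟩ := hseg.bddAbove_image hFc.continuousOn
    exact ⟨t, segment ℝ x y, (convex_segment x y).isPreconnected, left_mem_segment ℝ x y,
      right_mem_segment ℝ x y, fun z hz => ht (Set.mem_image_of_mem F hz)⟩
  set c := sInf T
  have hdc : d ≤ c := le_csInf hTne hTd
  obtain ⟨t, ht⟩ := exists_step_lt hF (isCompact_sublevel hFc hcoer c)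
    fun z hz => hcrit z (hdc.trans hz.ge)
  set η : H → H := fun z => z - t • coordGradient F z
  have hη : Continuous η := by
    have := continuous_coordGradient hF
    fun_prop
  -- The step still goes below `c` from a slightly larger sublevel set.
  obtain ⟨c', hcc', hc'⟩ : ∃ c' > c, ∀ z, F z ≤ c' → F (η z) < c := by
    have hB : IsCompact ({z | F z ≤ c + 1} ∩ {z | c ≤ F (η z)}) :=
      (isCompact_sublevel hFc hcoer (c + 1)).inter_right
        (isClosed_le continuous_const (hFc.comp hη))
    rcases Set.eq_empty_or_nonempty ({z | F z ≤ c + 1} ∩ {z | c ≤ F (η z)}) with hE | hE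
    · refine ⟨c + 1, by linarith, fun z hz => not_le.1 fun h => ?_⟩
      exact hE.subset (show z ∈ _ from ⟨hz, h⟩)
    · obtain ⟨w, hw, hmin⟩ := hB.exists_isMinOn hE hFc.continuousOn
      have hcw : c < F w := not_le.1 fun h => (ht w h).not_ge hw.2
      refine ⟨(c + F w) / 2, by linarith, fun z hz => not_le.1 fun h => ?_⟩
      have hw1 : F w ≤ c + 1 := hw.1
      have : F w ≤ F z := hmin ⟨show F z ≤ c + 1 by linarith, h⟩
      linarith
  obtain ⟨τ, ⟨K, hK, hxK, hyK, hKτ⟩, hτ⟩ := exists_lt_of_csInf_lt hTne hcc'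
  have hKc : ∀ z ∈ K, F z ≤ c' := fun z hz => (hKτ z hz).trans hτ.le
  obtain ⟨w, hw, hmax⟩ := (isCompact_sublevel hFc hcoer c').exists_isMaxOn ⟨x, hKc x hxK⟩
    (hFc.comp hη).continuousOn
  have hmem : F (η w) ∈ T := by
    refine ⟨η '' K, hK.image η hη.continuousOn, ⟨x, hxK, ?_⟩, ⟨y, hyK, ?_⟩, ?_⟩
    · simp [η, coordGradient_eq_zero hx]
    · simp [η, coordGradient_eq_zero hy]
    · rintro _ ⟨z, hz, rfl⟩
      exact hmax (hKc z hz)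
  exact (csInf_le ⟨d, hTd⟩ hmem).not_gt (hc' w hw)

end Descent

/-! ### Coercivity of `μ + lam * J` and minimizers on both sides of a level of `μ` -/

section Parameter

variable {H : Type*} [NormedAddCommGroup H] {J μ : H → ℝ}

theorem tendsto_add_mul_atTop (hμ_coercive : Tendsto μ (cobounded H) atTop)
    (hlow : ∀ ε : ℝ, 0 < ε → ∃ C : ℝ, ∀ u, -C - ε * μ u ≤ J u) {lam : ℝ} (hlam : 0 < lam) :
    Tendsto (fun u => μ u + lam * J u) (cobounded H) atTop := by
  obtain ⟨C, hC⟩ := hlow (1 / (2 * lam)) (by positivity)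
  refine tendsto_atTop_mono (f := fun u => (1 / 2) * μ u + -(lam * C)) (fun u => ?_)
    (tendsto_atTop_add_const_right _ _ (hμ_coercive.const_mul_atTop (by norm_num)))
  have h := mul_le_mul_of_nonneg_left (hC u) hlam.le
  have e : lam * (-C - 1 / (2 * lam) * μ u) = -(lam * C) - 1 / 2 * μ u := by
    field_simp
  linarith

variable [NormedSpace ℝ H] [FiniteDimensional ℝ H]

theorem exists_lower_bound_of_liminf_nonneg (hJ : Continuous J) (hμ : Continuous μ)
    (hμ_coercive : Tendsto μ (cobounded H) atTop) (hμ_nonneg : ∀ u, 0 ≤ μ u)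
    (h_liminf : 0 ≤ liminf (fun u => ((J u / μ u : ℝ) : EReal)) (comap μ atTop))
    {ε : ℝ} (hε : 0 < ε) : ∃ C : ℝ, ∀ u, -C - ε * μ u ≤ J u := by
  have hlt : ((-ε : ℝ) : EReal) < liminf (fun u => ((J u / μ u : ℝ) : EReal)) (comap μ atTop) :=
    lt_of_lt_of_le (by exact_mod_cast neg_lt_zero.2 hε) h_liminf
  obtain ⟨R, hR⟩ := eventually_atTop.1 (eventually_comap.1 (eventually_lt_of_lt_liminf hlt))
  obtain ⟨m, hm⟩ := (isCompact_sublevel hμ hμ_coercive (max R 1)).bddBelow_image hJ.continuousOn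
  refine ⟨max (-m) 0, fun u => ?_⟩
  have h0 := mul_nonneg hε.le (hμ_nonneg u)
  rcases le_total (μ u) (max R 1) with h | h
  · have := hm (Set.mem_image_of_mem J h)
    linarith [le_max_left (-m) 0]
  · have hpos : 0 < μ u := lt_of_lt_of_le (by positivity) h
    have h1 : -ε < J u / μ u := by
      exact_mod_cast hR (μ u) ((le_max_left _ _).trans h) u rfl
    rw [lt_div_iff₀ hpos] at h1
    linarith [le_max_right (-m) 0]

theorem exists_global_minimizer (hJ : Continuous J) (hμ : Continuous μ)
    (hμ_coercive : Tendsto μ (cobounded H) atTop)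
    (hlow : ∀ ε : ℝ, 0 < ε → ∃ C : ℝ, ∀ u, -C - ε * μ u ≤ J u) {lam : ℝ} (hlam : 0 < lam) :
    ∃ u, ∀ v, μ u + lam * J u ≤ μ v + lam * J v :=
  Continuous.exists_forall_le (f := fun u => μ u + lam * J u) (by fun_prop)
    (Metric.cobounded_eq_cocompact (α := H) ▸ tendsto_add_mul_atTop hμ_coercive hlow hlam)

/-- The parameters in a compact interval `[a, b]` for which `μ + lam * J` has a global minimizer in
a closed set `S` form a closed set: the minimizers stay in a fixed compact set. -/
theorem isClosed_setOf_exists_minimizer (hJ : Continuous J) (hμ : Continuous μ)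
    (hμ_coercive : Tendsto μ (cobounded H) atTop) (hμ_nonneg : ∀ u, 0 ≤ μ u) (hμ_zero : μ 0 = 0)
    (hlow : ∀ ε : ℝ, 0 < ε → ∃ C : ℝ, ∀ u, -C - ε * μ u ≤ J u) {a b : ℝ} (ha : 0 < a)
    (hab : a ≤ b) {S : Set H} (hS : IsClosed S) :
    IsClosed {lam | lam ∈ Set.Icc a b ∧
      ∃ u ∈ S, ∀ v, μ u + lam * J u ≤ μ v + lam * J v} := by
  have hb : 0 < b := ha.trans_le hab
  obtain ⟨C, hC⟩ := hlow (1 / (2 * b)) (by positivity)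
  set M := 2 * b * |J 0 + C|
  have hcpt : IsCompact ((Set.Icc a b ×ˢ {u | μ u ≤ M}) ∩
      {p : ℝ × H | p.2 ∈ S ∧ ∀ v, μ p.2 + p.1 * J p.2 ≤ μ v + p.1 * J v}) := by
    refine (isCompact_Icc.prod (isCompact_sublevel hμ hμ_coercive M)).inter_right ?_
    refine (hS.preimage continuous_snd).inter ?_
    change IsClosed {p : ℝ × H | ∀ v, μ p.2 + p.1 * J p.2 ≤ μ v + p.1 * J v}
    rw [Set.ofPred_forall]
    exact isClosed_iInter fun v => isClosed_le (by fun_prop) (by fun_prop)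
  convert (hcpt.image continuous_fst).isClosed using 1
  ext lam
  constructor
  · rintro ⟨hlam, u, huS, hu⟩
    refine ⟨(lam, u), ⟨⟨hlam, show μ u ≤ M from ?_⟩, huS, hu⟩, rfl⟩
    have hlam0 : 0 < lam := ha.trans_le hlam.1
    have h0 := hu 0
    have h1 := mul_le_mul_of_nonneg_left (hC u) hlam0.le
    have h2 : lam * (1 / (2 * b) * μ u) ≤ 1 / 2 * μ u := by
      have : lam * (1 / (2 * b)) ≤ 1 / 2 := by
        rw [mul_one_div, div_le_iff₀ (by positivity)]
        linarith [hlam.2]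
      nlinarith [mul_le_mul_of_nonneg_right this (hμ_nonneg u)]
    have h3 : lam * (J 0 + C) ≤ b * |J 0 + C| :=
      (mul_le_mul_of_nonneg_left (le_abs_self _) hlam0.le).trans
        (mul_le_mul_of_nonneg_right hlam.2 (abs_nonneg _))
    rw [hμ_zero] at h0
    simp only [M]
    linarith
  · rintro ⟨⟨lam', u⟩, ⟨⟨hlam, -⟩, huS, hu⟩, rfl⟩
    exact ⟨hlam, u, huS, hu⟩

theorem exists_common_parameter (hJ : Continuous J) (hμ : Continuous μ)
    (hμ_coercive : Tendsto μ (cobounded H) atTop) (hμ_nonneg : ∀ u, 0 ≤ μ u) (hμ_zero : μ 0 = 0)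
    (hlow : ∀ ε : ℝ, 0 < ε → ∃ C : ℝ, ∀ u, -C - ε * μ u ≤ J u) {s : ℝ} (hs : 0 < s)
    (hinf : ∃ w, ∀ u, μ u ≤ s → J w < J u) :
    ∃ lam : ℝ, 0 < lam ∧
      (∃ u, μ u ≤ s ∧ ∀ v, μ u + lam * J u ≤ μ v + lam * J v) ∧
      (∃ u, s ≤ μ u ∧ ∀ v, μ u + lam * J u ≤ μ v + lam * J v) := by
  obtain ⟨C, hC⟩ := hlow 1 one_pos
  -- `a` is so small that every minimizer for the parameter `a` satisfies `μ ≤ s`.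
  obtain ⟨a, ha, ha1, ha2⟩ : ∃ a : ℝ, 0 < a ∧ a ≤ 1 / 2 ∧ 2 * a * |J 0 + C| ≤ s := by
    refine ⟨min (1 / 2) (s / (2 * (|J 0 + C| + 1))), by positivity, min_le_left _ _, ?_⟩
    have h := min_le_right (1 / 2) (s / (2 * (|J 0 + C| + 1)))
    rw [le_div_iff₀ (by positivity)] at h
    have : 0 < min (1 / 2) (s / (2 * (|J 0 + C| + 1))) := by positivity
    linarith
  obtain ⟨w, hw⟩ := hinf
  obtain ⟨q, hq, hqmin⟩ := (isCompact_sublevel hμ hμ_coercive s).exists_isMinOn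
    ⟨0, show μ 0 ≤ s by linarith⟩ hJ.continuousOn
  have hδ : 0 < J q - J w := sub_pos.2 (hw q hq)
  -- `b` is so large that `w` beats every point of `{μ ≤ s}` for the parameter `b`.
  set b := a + (μ w / (J q - J w) + 1)
  have hab : a ≤ b := by
    have := div_nonneg (hμ_nonneg w) hδ.le
    simp only [b]
    linarith
  have hb : 0 < b := ha.trans_le hab
  have hbw : μ w < b * (J q - J w) := by
    rw [← div_lt_iff₀ hδ]
    simp only [b]
    linarith
  have hmin {lam : ℝ} (h : 0 < lam) := exists_global_minimizer hJ hμ hμ_coercive hlow h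
  obtain ⟨lam, hlam, ⟨-, hl⟩, -, hr⟩ := isPreconnected_closed_iff.1 (isPreconnected_Icc (a := a)
    (b := b)) _ _
    (isClosed_setOf_exists_minimizer hJ hμ hμ_coercive hμ_nonneg hμ_zero hlow ha hab
      (isClosed_le hμ (continuous_const (y := s))))
    (isClosed_setOf_exists_minimizer hJ hμ hμ_coercive hμ_nonneg hμ_zero hlow ha hab
      (isClosed_le (continuous_const (y := s)) hμ))
    (fun lam hlam => by
      obtain ⟨u, hu⟩ := hmin (ha.trans_le hlam.1)
      rcases le_total (μ u) s with h | h
      · exact Or.inl ⟨hlam, u, h, hu⟩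
      · exact Or.inr ⟨hlam, u, h, hu⟩)
    (by
      obtain ⟨u, hu⟩ := hmin ha
      refine ⟨a, ⟨le_rfl, hab⟩, ⟨le_rfl, hab⟩, u, show μ u ≤ s from ?_, hu⟩
      have h0 := hu 0
      have h1 := mul_le_mul_of_nonneg_left (hC u) ha.le
      have h2 := mul_le_mul_of_nonneg_right ha1 (hμ_nonneg u)
      have h3 := mul_le_mul_of_nonneg_left (le_abs_self (J 0 + C)) ha.le
      rw [hμ_zero] at h0
      linarith)
    (by
      obtain ⟨u, hu⟩ := hmin hb
      refine ⟨b, ⟨hab, le_rfl⟩, ⟨hab, le_rfl⟩, u, show s ≤ μ u from ?_, hu⟩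
      by_contra! h
      have h0 := hu w
      have h1 : J q ≤ J u := hqmin (show μ u ≤ s from h.le)
      have h2 := mul_le_mul_of_nonneg_left h1 hb.le
      linarith [hμ_nonneg u])
  exact ⟨lam, ha.trans_le hlam.1, hl, hr⟩

end Parameter

/-! ### Three critical points -/

theorem mainTheorem2 {H : Type*} [NormedAddCommGroup H] [NormedSpace ℝ H]
    [FiniteDimensional ℝ H] (J μ : H → ℝ)
    (hJ : ContDiff ℝ 1 J) (hμ : ContDiff ℝ 1 μ)
    (hμ_nonneg : ∀ u, 0 ≤ μ u) (hμ_zero : μ 0 = 0)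
    (hμ_coercive : Tendsto μ (cobounded H) atTop)
    (r s : ℝ) (hr : 0 < r) (hrs : r < s)
    (h_liminf : 0 ≤ liminf (fun u => ((J u / μ u : ℝ) : EReal)) (comap μ atTop))
    (h_inf : (⨅ u : H, (J u : EReal)) < (⨅ (u : H) (_ : μ u ≤ s), (J u : EReal)))
    (h_zero : (J 0 : EReal) ≤ ⨅ (u : H) (_ : r ≤ μ u ∧ μ u ≤ s), (J u : EReal)) :
    ∃ lam : ℝ, 0 < lam ∧
      3 ≤ {u : H | HasFDerivAt (fun v => μ v + lam * J v) (0 : H →L[ℝ] ℝ) u}.encard := by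
  have hlow (ε : ℝ) (hε : 0 < ε) := exists_lower_bound_of_liminf_nonneg hJ.continuous
    hμ.continuous hμ_coercive hμ_nonneg h_liminf hε
  have hinf : ∃ w, ∀ u, μ u ≤ s → J w < J u := by
    obtain ⟨w, hw⟩ := iInf_lt_iff.1 h_inf
    exact ⟨w, fun u hu => by exact_mod_cast hw.trans_le (iInf₂_le u hu)⟩
  have hzero (u : H) (h1 : r ≤ μ u) (h2 : μ u ≤ s) : J 0 ≤ J u := by
    exact_mod_cast h_zero.trans (iInf₂_le u ⟨h1, h2⟩)
  obtain ⟨lam, hlam, ⟨x, hxs, hx⟩, y, hys, hy⟩ := exists_common_parameter hJ.continuous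
    hμ.continuous hμ_coercive hμ_nonneg hμ_zero hlow (hr.trans hrs) hinf
  refine ⟨lam, hlam, ?_⟩
  set F : H → ℝ := fun v => μ v + lam * J v
  have hF : ContDiff ℝ 1 F := hμ.add (contDiff_const.mul hJ)
  have hF0 : F 0 = lam * J 0 := by simp [F, hμ_zero]
  have hband (u : H) (h1 : r ≤ μ u) (h2 : μ u ≤ s) : F 0 + r ≤ F u := by
    have := mul_le_mul_of_nonneg_left (hzero u h1 h2) hlam.le
    rw [hF0]
    simp only [F]
    linarith
  have hxr : μ x < r := by
    by_contra! h
    linarith [hband x h hxs, show F x ≤ F 0 from hx 0]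
  have hyc : fderiv ℝ F y = 0 :=
    (isMinOn_univ_iff.2 hy).isLocalMin univ_mem |>.fderiv_eq_zero
  have hxc : fderiv ℝ F x = 0 :=
    (isMinOn_univ_iff.2 hx).isLocalMin univ_mem |>.fderiv_eq_zero
  obtain ⟨z, hz, hzc⟩ := exists_critical_point_of_barrier (d := F 0 + r) hF
    (tendsto_add_mul_atTop hμ_coercive hlow hlam) hxc hyc fun K hK hxK hyK => by
      obtain ⟨z, hzK, hz⟩ := hK.intermediate_value hxK hyK hμ.continuous.continuousOn
        (show r ∈ Set.Icc (μ x) (μ y) from ⟨hxr.le, hrs.le.trans hys⟩)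
      exact ⟨z, hzK, hband z hz.ge (hz.le.trans hrs.le)⟩
  have hcrit (u : H) (hu : fderiv ℝ F u = 0) : HasFDerivAt F (0 : H →L[ℝ] ℝ) u :=
    hu ▸ (hF.differentiable one_ne_zero u).hasFDerivAt
  have hxy : x ≠ y := fun h => by subst h; linarith
  have hxz : x ≠ z := fun h => by subst h; linarith [show F x ≤ F 0 from hx 0]
  have hyz : y ≠ z := fun h => by subst h; linarith [show F y ≤ F 0 from hy 0]
  have hcard : ({x, y, z} : Set H).encard = 3 :=
    Set.encard_eq_three.2 ⟨x, y, z, hxy, hxz, hyz, rfl⟩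
  rw [← hcard]
  refine Set.encard_le_encard ?_
  rintro u (rfl | rfl | rfl)
  exacts [hcrit _ hxc, hcrit _ hyc, hcrit _ hzc]
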